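/- Let $C\ge 1$, let $\mathcal S_1,\dots,\mathcal S_C$ be Polish spaces with their Borel $\sigma$-algebras, and let $(X_{n,i})_{n\ge 1,\,1\le i\le C}$ be random variables on a probability space $(\Omega,\mathcal F,P)$, with $X_{n,i}$ taking values in $\mathcal S_i$. Suppose that the system is infinite multi-exchangeable: for all $N_1,\dots,N_C\in\mathbb N$ and all permutations $\sigma_i$ of $\{1,\dots,N_i\}$, the families $(X_{\sigma_i(n),i})_{1\le n\le N_i,\,1\le i\le C}$ and $(X_{n,i})_{1\le n\le N_i,\,1\le i\le C}$ have the same law. A directing measure vector of the system is a family $(\Lambda_i)_{1\le i\le C}$ of random probability measures, $\Lambda_i$ on $\mathcal S_i$, such that almost surely, for every $i$, $\frac1N\sum_{n=1}^N\delta_{X_{n,i}}\to\Lambda_i$ weakly as $N\to\infty$. For $k\ge1$, call a measurable set $B\subset\mathcal S_1^{\infty}\times\cdots\times\mathcal S_C^{\infty}$ $k$-multi-exchangeable if, for all permutations $\sigma_1,\dots,\sigma_C$ of $\{1,2,\dots\}$ fixing every $n\ge k+1$, $$(x_{n,i})_{n\ge1,\,1\le i\le C}\in B\iff (x_{\sigma_i(n),i})_{n\ge1,\,1\le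 i\le C}\in B .$$ Let $\mathcal E_k$ be the $\sigma$-algebra of all events $\{(X_{n,i})_{n\ge1,\,1\le i\le C}\in B\}$ with $B$ measurable and $k$-multi-exchangeable, let $\mathcal E=\bigcap_{k\ge1}\mathcal E_k$ be the multi-exchangeable $\sigma$-algebra, and let $\mathcal T=\bigcap_{k\ge1}\sigma\bigl((X_{n,i})_{n\ge k,\,1\le i\le C}\bigr)$ be the multi-tail $\sigma$-algebra. Two $\sigma$-algebras are said to be equal a.s. if every event of either one differs from some event of the other by a $P$-null set. Then a directing measure vector exists, and for every directing measure vector $(\Lambda_i)_{1\le i\le C}$, $$\sigma\bigl((\Lambda_i)_{1\le i\le C}\bigr)=\mathcal T=\mathcal E\quad\text{a.s.}$$ If moreover all the $X_{n,i}$ ($n\ge1$, $1\le i\le C$) are independent, then $P(A)\in\{0,1\}$ for all $A\in\mathcal E$. -/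

import Mathlib

open MeasureTheory ProbabilityTheory Filter Topology

namespace MultiExch

/-- A finite multi-class system `(Y i n)`, `n < N i`, `i < C`, with class `i` taking values in `S i`,
is multi-exchangeable if its joint law is invariant under permutations within the classes. -/
def FiniteMultiExchangeable {Ω : Type*} [MeasurableSpace Ω] {C : ℕ} {S : Fin C → Type*}
    [∀ i, MeasurableSpace (S i)] (P : Measure Ω) {N : Fin C → ℕ}
    (Y : ∀ i, Fin (N i) → Ω → S i) : Prop :=
  ∀ σ : ∀ i, Equiv.Perm (Fin (N i)),
    P.map (fun ω i n => Y i (σ i n) ω) = P.map (fun ω i n => Y i n ω)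

/-- A multi-class system with infinite classes is multi-exchangeable if each of its finite
sub-systems, consisting of the first `N i` particles of every class `i`, is.
Particles are numbered from `0`. -/
def MultiExchangeable {Ω : Type*} [MeasurableSpace Ω] {C : ℕ} {S : Fin C → Type*}
    [∀ i, MeasurableSpace (S i)] (P : Measure Ω) (X : ∀ i, ℕ → Ω → S i) : Prop :=
  ∀ N : Fin C → ℕ, FiniteMultiExchangeable P (fun i (n : Fin (N i)) => X i n)

/-- The empirical measure `(N + 1)⁻¹ ∑_{n ≤ N} δ_{x n}` of the first `N + 1` points. -/
noncomputable def empiricalMeasure {S : Type*} [MeasurableSpace S] (x : ℕ → S) (N : ℕ) :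
    ProbabilityMeasure S :=
  ⟨((N + 1 : ℕ) : ENNReal)⁻¹ • ∑ n ∈ Finset.range (N + 1), Measure.dirac (x n), ⟨by
    rw [Measure.smul_apply, Measure.finsetSum_apply]
    simp only [measure_univ, Finset.sum_const, Finset.card_range, nsmul_eq_mul, mul_one,
      smul_eq_mul]
    exact ENNReal.inv_mul_cancel (by simp) (ENNReal.natCast_ne_top _)⟩⟩

/-- `Λ` is (a version of) the directing measure of the sequence `Y`: a random probability measure
which is almost surely the weak limit of the empirical measures of `Y`. -/
def IsDirectingMeasure {Ω : Type*} [MeasurableSpace Ω] {S : Type*} [TopologicalSpace S]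
    [MeasurableSpace S] [OpensMeasurableSpace S] (P : Measure Ω) (Y : ℕ → Ω → S)
    (Λ : Ω → ProbabilityMeasure S) : Prop :=
  Measurable Λ ∧
    ∀ᵐ ω ∂P, Tendsto (fun N => empiricalMeasure (fun n => Y n ω) N) atTop (𝓝 (Λ ω))

/-- `Λ` is (a version of) the directing measure vector of the multi-class system `X`. -/
def IsDirectingMeasureVector {Ω : Type*} [MeasurableSpace Ω] {C : ℕ} {S : Fin C → Type*}
    [∀ i, TopologicalSpace (S i)] [∀ i, MeasurableSpace (S i)] [∀ i, OpensMeasurableSpace (S i)]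
    (P : Measure Ω) (X : ∀ i, ℕ → Ω → S i) (Λ : ∀ i, Ω → ProbabilityMeasure (S i)) : Prop :=
  ∀ i, IsDirectingMeasure P (X i) (Λ i)

/-- The σ-algebra on `Ω` generated by a vector of random probability measures. -/
@[reducible] def directingSigma {Ω : Type*} {C : ℕ} {S : Fin C → Type*} [∀ i, MeasurableSpace (S i)]
    (Λ : ∀ i, Ω → ProbabilityMeasure (S i)) : MeasurableSpace Ω :=
  MeasurableSpace.comap (fun ω i => Λ i ω) inferInstance

/-- A set of configurations is `k`-multi-exchangeable if it is invariant under all permutations,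
within the classes, of the first `k` coordinates `0, …, k - 1`, every other coordinate being
fixed. -/
def IsKMultiExchangeableSet {C : ℕ} {S : Fin C → Type*} (k : ℕ) (B : Set (∀ i, ℕ → S i)) : Prop :=
  ∀ σ : Fin C → Equiv.Perm ℕ, (∀ i n, k ≤ n → σ i n = n) →
    ∀ x : ∀ i, ℕ → S i, x ∈ B ↔ (fun i n => x i (σ i n)) ∈ B

/-- The σ-algebra of the measurable `k`-multi-exchangeable sets of configurations. -/
@[reducible] def kMultiExchangeableSets {C : ℕ} (S : Fin C → Type*) [∀ i, MeasurableSpace (S i)] (k : ℕ) :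
    MeasurableSpace (∀ i, ℕ → S i) where
  MeasurableSet' B := MeasurableSet B ∧ IsKMultiExchangeableSet k B
  measurableSet_empty := ⟨MeasurableSet.empty, fun _ _ _ => Iff.rfl⟩
  measurableSet_compl B hB := ⟨hB.1.compl, fun σ hσ x => not_congr (hB.2 σ hσ x)⟩
  measurableSet_iUnion f hf := ⟨MeasurableSet.iUnion fun j => (hf j).1, fun σ hσ x => by
    simp only [Set.mem_iUnion]
    exact exists_congr fun j => (hf j).2 σ hσ x⟩

/-- The σ-algebra `𝓔_k` on `Ω` of the events `{X ∈ B}`, with `B` measurable and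
`k`-multi-exchangeable. -/
@[reducible] def kMultiExchangeableSigma {Ω : Type*} {C : ℕ} {S : Fin C → Type*} [∀ i, MeasurableSpace (S i)]
    (X : ∀ i, ℕ → Ω → S i) (k : ℕ) : MeasurableSpace Ω :=
  MeasurableSpace.comap (fun ω i n => X i n ω) (kMultiExchangeableSets S k)

/-- The multi-exchangeable σ-algebra `𝓔 = ⋂_{k ≥ 1} 𝓔_k`. -/
@[reducible] def multiExchangeableSigma {Ω : Type*} {C : ℕ} {S : Fin C → Type*} [∀ i, MeasurableSpace (S i)]
    (X : ∀ i, ℕ → Ω → S i) : MeasurableSpace Ω :=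
  ⨅ (k : ℕ) (_ : 1 ≤ k), kMultiExchangeableSigma X k

/-- The multi-tail σ-algebra `⋂_k σ(X i n : n ≥ k, i < C)`. -/
@[reducible] def multiTailSigma {Ω : Type*} {C : ℕ} {S : Fin C → Type*} [∀ i, MeasurableSpace (S i)]
    (X : ∀ i, ℕ → Ω → S i) : MeasurableSpace Ω :=
  ⨅ k : ℕ, ⨆ (i : Fin C) (n : ℕ) (_ : k ≤ n), MeasurableSpace.comap (X i n) inferInstance

/-- Inclusion almost surely of `m₁` in `m₂`: each event of `m₁` differs from some event of `m₂` by
a null set. -/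
def SigmaAELE {Ω : Type*} (m₁ m₂ : MeasurableSpace Ω) {mΩ : MeasurableSpace Ω} (P : Measure Ω) :
    Prop :=
  ∀ A : Set Ω, MeasurableSet[m₁] A → ∃ B : Set Ω, MeasurableSet[m₂] B ∧ A =ᵐ[P] B

/-- Equality almost surely of two σ-algebras. -/
def SigmaAEEq {Ω : Type*} (m₁ m₂ : MeasurableSpace Ω) {mΩ : MeasurableSpace Ω} (P : Measure Ω) :
    Prop :=
  SigmaAELE m₁ m₂ P ∧ SigmaAELE m₂ m₁ P

end MultiExch

/-! Write $\mathcal F_X$ for the σ-algebra generated by the whole system. The inclusion $\mathcal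
T\subset\mathcal E$ is exact, because permuting the first $k$ indices leaves the later coordinates
alone. The substance is that $\mathcal E\subset\sigma(\Lambda)$ up to null sets.

For measurable $D\subset\mathcal S_i$, exchangeability makes the second and mixed moments of the
indicators of $\{X_{n,i}\in D\}$ constant, so an $L^2$ estimate yields a.s. convergence of their
averages to a tail measurable frequency (`ae_exists_tendsto_average`). The core is
`MultiExchangeable.integral_mul_prod_indicator`: tested against a bounded $\mathcal E$-measurable
$g$, a product of indicators at distinct sites may be replaced by the product of the frequencies.
Since $g$ is invariant under finite permutations, the index of one factor can be moved to any fresh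
index, hence averaged over fresh indices, and the average tends to the frequency.

With a single site this identifies frequencies as conditional probabilities given $\mathcal T$.
Regular conditional laws given $\mathcal T$ then form a vector $\Lambda_0$ realizing all
frequencies, and it is directing because countably many sets determine weak convergence. For
$A\in\mathcal E$, the difference $1_A-P(A\mid\sigma(\Lambda_0))$ integrates to zero over every
rectangle, since products of frequencies are a.s. $\sigma(\Lambda_0)$-measurable; hence over all of
$\mathcal F_X$, to which $A$ belongs, so it vanishes a.s. The zero-one law follows from $\mathcal
E=\mathcal T$ a.s. and Kolmogorov's law. -/

namespace MultiExch

/-! ### Almost sure convergence of averages from second moments -/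

section Averages

variable {Ω : Type*} [MeasurableSpace Ω] {P : Measure Ω}

/-- The second moment of a linear combination of variables whose second moments and whose mixed
second moments are constant. -/
theorem integral_sq_sum_of_exchangeable {u : ℕ → Ω → ℝ}
    (hint : ∀ n m, Integrable (fun ω => u n ω * u m ω) P) {a b : ℝ}
    (ha : ∀ n, ∫ ω, u n ω * u n ω ∂P = a) (hb : ∀ n m, n ≠ m → ∫ ω, u n ω * u m ω ∂P = b)
    (s : Finset ℕ) (c : ℕ → ℝ) :
    ∫ ω, (∑ n ∈ s, c n * u n ω) ^ 2 ∂P = (a - b) * ∑ n ∈ s, c n ^ 2 + b * (∑ n ∈ s, c n) ^ 2 := by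
  have h1 : ∀ ω, (∑ n ∈ s, c n * u n ω) ^ 2
      = ∑ n ∈ s, ∑ m ∈ s, c n * c m * (u n ω * u m ω) := by
    intro ω
    rw [sq, Finset.sum_mul_sum]
    exact Finset.sum_congr rfl fun n _ => Finset.sum_congr rfl fun m _ => by ring
  have h2 : ∀ n m, ∫ ω, u n ω * u m ω ∂P = b + if n = m then a - b else 0 := by
    intro n m
    split_ifs with h
    · subst h; rw [ha]; ring
    · rw [hb n m h]; ring
  simp_rw [h1]
  rw [integral_finsetSum _ fun n _ => integrable_finsetSum _ fun m _ => (hint n m).const_mul _]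
  simp_rw [integral_finsetSum s fun m _ => (hint _ m).const_mul _, integral_const_mul, h2, mul_add,
    mul_ite, mul_zero, Finset.sum_add_distrib]
  simp only [Finset.sum_ite_eq]
  rw [sq (∑ n ∈ s, c n), Finset.sum_mul_sum, Finset.mul_sum, Finset.mul_sum, add_comm]
  congr 1
  · refine Finset.sum_congr rfl fun n hn => ?_
    rw [if_pos hn]; ring
  · refine Finset.sum_congr rfl fun n _ => ?_
    rw [Finset.mul_sum]
    exact Finset.sum_congr rfl fun m _ => by ring

/-- The mean square distance of two averages of an exchangeable sequence. -/
theorem integral_sq_average_sub_average {u : ℕ → Ω → ℝ}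
    (hint : ∀ n m, Integrable (fun ω => u n ω * u m ω) P) {a b : ℝ}
    (ha : ∀ n, ∫ ω, u n ω * u n ω ∂P = a) (hb : ∀ n m, n ≠ m → ∫ ω, u n ω * u m ω ∂P = b)
    {N M : ℕ} (hN : 0 < N) (hNM : N ≤ M) :
    ∫ ω, ((∑ n ∈ Finset.range N, u n ω) / N - (∑ n ∈ Finset.range M, u n ω) / M) ^ 2 ∂P
      = (a - b) * (1 / N - 1 / M) := by
  have hN' : (N : ℝ) ≠ 0 := by positivity
  have hM' : (M : ℝ) ≠ 0 := by have : 0 < M := hN.trans_le hNM; positivity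
  have hf : (Finset.range M).filter (· < N) = Finset.range N := by
    ext n; simp only [Finset.mem_filter, Finset.mem_range]; omega
  -- The difference of the two averages has these weights; they sum to zero, which removes the `b`
  -- term of the second moment.
  set c : ℕ → ℝ := fun n => (if n < N then 1 / (N : ℝ) else 0) - 1 / M with hc
  have h1 : ∀ ω, (∑ n ∈ Finset.range N, u n ω) / N - (∑ n ∈ Finset.range M, u n ω) / M
      = ∑ n ∈ Finset.range M, c n * u n ω := by
    intro ω
    simp only [hc, sub_mul, ite_mul, zero_mul, Finset.sum_sub_distrib]
    rw [← Finset.sum_filter, hf, ← Finset.mul_sum, ← Finset.mul_sum]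
    ring
  have h2 : ∑ n ∈ Finset.range M, c n = 0 := by
    simp only [hc, Finset.sum_sub_distrib]
    rw [← Finset.sum_filter, hf]
    simp [hN', hM']
  have h3 : ∑ n ∈ Finset.range M, c n ^ 2 = 1 / N - 1 / M := by
    have : ∀ n, c n ^ 2
        = (if n < N then (1 / (N : ℝ)) ^ 2 - 2 * (1 / N) * (1 / M) else 0) + (1 / (M : ℝ)) ^ 2 := by
      intro n
      simp only [hc]
      split_ifs <;> ring
    simp only [this, Finset.sum_add_distrib]
    rw [← Finset.sum_filter, hf]
    simp only [Finset.sum_const, Finset.card_range, nsmul_eq_mul]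
    field_simp
    ring
  simp_rw [h1]
  rw [integral_sq_sum_of_exchangeable hint ha hb, h2, h3]
  ring

/-- The averages of a sequence with values in `[0, 1]`, whose second moments and whose mixed second
moments are constant, converge almost surely. -/
theorem ae_exists_tendsto_average [IsProbabilityMeasure P] {u : ℕ → Ω → ℝ} (hm : ∀ n, Measurable (u n))
    (h0 : ∀ n ω, 0 ≤ u n ω) (h1 : ∀ n ω, u n ω ≤ 1) {a b : ℝ}
    (ha : ∀ n, ∫ ω, u n ω * u n ω ∂P = a) (hb : ∀ n m, n ≠ m → ∫ ω, u n ω * u m ω ∂P = b) :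
    ∀ᵐ ω ∂P, ∃ l, Tendsto (fun N : ℕ => (∑ n ∈ Finset.range N, u n ω) / N) atTop (𝓝 l) := by
  have hint : ∀ n m, Integrable (fun ω => u n ω * u m ω) P := fun n m =>
    Integrable.of_bound ((hm n).mul (hm m)).aestronglyMeasurable 1 (ae_of_all _ fun ω => by
      rw [Real.norm_eq_abs, abs_of_nonneg (mul_nonneg (h0 n ω) (h0 m ω))]
      exact mul_le_one₀ (h1 n ω) (h0 m ω) (h1 m ω))
  have hab : a - b ≤ 1 := by
    have ha1 : a ≤ 1 := by
      rw [← ha 0]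
      calc ∫ ω, u 0 ω * u 0 ω ∂P ≤ ∫ _, (1 : ℝ) ∂P :=
            integral_mono (hint 0 0) (integrable_const _)
              fun ω => mul_le_one₀ (h1 0 ω) (h0 0 ω) (h1 0 ω)
        _ = 1 := by simp
    have hb0 : 0 ≤ b := by
      rw [← hb 0 1 zero_ne_one]
      exact integral_nonneg fun ω => mul_nonneg (h0 0 ω) (h0 1 ω)
    linarith
  set A : ℕ → Ω → ℝ := fun N ω => (∑ n ∈ Finset.range N, u n ω) / N with hA
  have hAm : ∀ N, Measurable (A N) := fun N =>
    (Finset.measurable_fun_sum _ fun n _ => hm n).div_const _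
  have hA0 : ∀ N ω, 0 ≤ A N ω := fun N ω =>
    div_nonneg (Finset.sum_nonneg fun n _ => h0 n ω) (Nat.cast_nonneg _)
  have hA1 : ∀ N ω, A N ω ≤ 1 := fun N ω => by
    refine div_le_one_of_le₀ ?_ (Nat.cast_nonneg _)
    calc ∑ n ∈ Finset.range N, u n ω ≤ ∑ n ∈ Finset.range N, (1 : ℝ) :=
          Finset.sum_le_sum fun n _ => h1 n ω
      _ = N := by simp
  -- Fourth powers are sparse enough for the $L^1$ increments, at most $(k+1)^{-2}$, to be summable,
  -- yet their consecutive ratios tend to $1$, so that monotone partial sums fill the gaps.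
  let e : ℕ → ℕ := fun k => (k + 1) ^ 4
  have hd1 : ∀ k ω, |A (e k) ω - A (e (k + 1)) ω| ≤ 1 := fun k ω => by
    rw [abs_le]
    constructor <;> linarith [hA0 (e k) ω, hA0 (e (k+1)) ω, hA1 (e k) ω, hA1 (e (k+1)) ω]
  have hdm : ∀ k, Measurable fun ω => |A (e k) ω - A (e (k + 1)) ω| := fun k =>
    ((hAm _).sub (hAm _)).abs
  have hL1 : ∀ k, ∫ ω, |A (e k) ω - A (e (k + 1)) ω| ∂P ≤ 1 / ((k + 1 : ℕ) : ℝ) ^ 2 := by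
    intro k
    set t : ℝ := ((k + 1 : ℕ) : ℝ) ^ 2 with ht
    have htpos : 0 < t := by positivity
    have hsq : ∫ ω, (A (e k) ω - A (e (k + 1)) ω) ^ 2 ∂P ≤ 1 / t ^ 2 := by
      have hle : e k ≤ e (k + 1) := Nat.pow_le_pow_left (by omega) 4
      have he : ((e k : ℕ) : ℝ) = t ^ 2 := by simp only [e, ht]; push_cast; ring
      rw [integral_sq_average_sub_average hint ha hb (by positivity) hle, he]
      have h4 : 0 ≤ 1 / ((e (k + 1) : ℕ) : ℝ) := by positivity
      have h5 : 1 / ((e (k + 1) : ℕ) : ℝ) ≤ 1 / t ^ 2 := by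
        rw [← he]
        exact one_div_le_one_div_of_le (by positivity) (by exact_mod_cast hle)
      nlinarith
    have hi1 : Integrable (fun ω => |A (e k) ω - A (e (k + 1)) ω|) P :=
      Integrable.of_bound (hdm k).aestronglyMeasurable 1
        (ae_of_all _ fun ω => by rw [Real.norm_eq_abs, abs_abs]; exact hd1 k ω)
    have hi2 : Integrable (fun ω => (A (e k) ω - A (e (k + 1)) ω) ^ 2) P :=
      Integrable.of_bound (((hAm _).sub (hAm _)).pow_const 2).aestronglyMeasurable 1
        (ae_of_all _ fun ω => by
          rw [Real.norm_eq_abs, abs_pow]; exact pow_le_one₀ (abs_nonneg _) (hd1 k ω))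
    -- The inequality $x\le \frac1{2t}+\frac t2x^2$ plays the role of Cauchy–Schwarz; this $t$
    -- matches the bound $t^{-2}$ on the mean square.
    calc ∫ ω, |A (e k) ω - A (e (k + 1)) ω| ∂P
        ≤ ∫ ω, (1 / (2 * t) + t / 2 * (A (e k) ω - A (e (k + 1)) ω) ^ 2) ∂P := by
          refine integral_mono hi1 ((integrable_const _).add (hi2.const_mul _)) fun ω => ?_
          simp only
          rw [← sq_abs (A (e k) ω - A (e (k + 1)) ω)]
          set x := |A (e k) ω - A (e (k + 1)) ω|
          have : 1 / (2 * t) + t / 2 * x ^ 2 - x = (t * x - 1) ^ 2 / (2 * t) := by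
            field_simp; ring
          have h6 : 0 ≤ (t * x - 1) ^ 2 / (2 * t) := by positivity
          linarith
      _ = 1 / (2 * t) + t / 2 * ∫ ω, (A (e k) ω - A (e (k + 1)) ω) ^ 2 ∂P := by
          rw [integral_add (integrable_const _) (hi2.const_mul _), integral_const_mul]
          simp
      _ ≤ 1 / (2 * t) + t / 2 * (1 / t ^ 2) := by gcongr
      _ = 1 / t := by field_simp; norm_num
  have hsum : ∀ᵐ ω ∂P, Summable fun k => |A (e k) ω - A (e (k + 1)) ω| := by
    have hfin : ∫⁻ ω, ∑' k, ENNReal.ofReal |A (e k) ω - A (e (k + 1)) ω| ∂P ≠ ⊤ := by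
      rw [lintegral_tsum fun k => (hdm k).ennreal_ofReal.aemeasurable]
      have hs : Summable fun k : ℕ => 1 / ((k + 1 : ℕ) : ℝ) ^ 2 :=
        (summable_nat_add_iff 1).2 (Real.summable_one_div_nat_pow.2 one_lt_two)
      refine ne_top_of_le_ne_top hs.tsum_ofReal_ne_top (ENNReal.tsum_le_tsum fun k => ?_)
      rw [← ofReal_integral_eq_lintegral_ofReal]
      · exact ENNReal.ofReal_le_ofReal (hL1 k)
      · exact Integrable.of_bound (hdm k).aestronglyMeasurable 1
          (ae_of_all _ fun ω => by rw [Real.norm_eq_abs, abs_abs]; exact hd1 k ω)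
      · exact ae_of_all _ fun ω => abs_nonneg _
    filter_upwards [ae_lt_top (Measurable.tsum
      fun k => (hdm k).ennreal_ofReal) hfin] with ω hω
    refine (ENNReal.summable_toReal hω.ne).congr fun k => ?_
    exact ENNReal.toReal_ofReal (abs_nonneg _)
  filter_upwards [hsum] with ω hω
  have hcau : CauchySeq fun k => A (e k) ω :=
    cauchySeq_of_summable_dist (hω.congr fun k => by rw [Real.dist_eq])
  obtain ⟨l, hl⟩ := cauchySeq_tendsto_of_complete hcau
  refine ⟨l, tendsto_div_of_monotone_of_exists_subseq_tendsto_div _ l ?_ fun r hr => ?_⟩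
  · exact monotone_nat_of_le_succ fun n => by
      rw [Finset.sum_range_succ]
      exact le_add_of_nonneg_right (h0 n ω)
  · refine ⟨e, ?_, ?_, hl⟩
    · have h7 : Tendsto (fun k : ℕ => (1 + 1 / ((k : ℝ) + 1)) ^ 4) atTop (𝓝 ((1 + 0) ^ 4)) :=
        (tendsto_const_nhds.add tendsto_one_div_add_atTop_nhds_zero_nat).pow 4
      rw [add_zero, one_pow] at h7
      filter_upwards [h7.eventually_le_const hr] with k hk
      have : ((e (k + 1) : ℕ) : ℝ) = (1 + 1 / ((k : ℝ) + 1)) ^ 4 * (e k : ℕ) := by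
        simp only [e]; push_cast; field_simp
      rw [this]
      gcongr
    · exact tendsto_atTop_mono (fun k => (Nat.le_succ k).trans (Nat.le_self_pow (by norm_num) _))
        tendsto_id

end Averages

/-! ### Rectangles and permutations of configurations -/

section Configurations

variable {C : ℕ} {S : Fin C → Type*} [∀ i, MeasurableSpace (S i)]

/-- The rectangles of configurations, which constrain finitely many coordinates of each class. -/
def rectangles (S : Fin C → Type*) [∀ i, MeasurableSpace (S i)] : Set (Set (∀ i, ℕ → S i)) :=
  {R | ∃ (D : ∀ i, ℕ → Set (S i)) (M : ℕ), (∀ i n, MeasurableSet (D i n)) ∧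
    (∀ i n, M ≤ n → D i n = Set.univ) ∧ R = {x | ∀ i n, x i n ∈ D i n}}

theorem measurable_coordinate (i : Fin C) (n : ℕ) :
    Measurable fun x : ∀ i, ℕ → S i => x i n :=
  (measurable_pi_apply n).comp (measurable_pi_apply i)

theorem isPiSystem_rectangles : IsPiSystem (rectangles S) := by
  rintro _ ⟨D, M, hD, hM, rfl⟩ _ ⟨D', M', hD', hM', rfl⟩ -
  refine ⟨fun i n => D i n ∩ D' i n, max M M', fun i n => (hD i n).inter (hD' i n),
    fun i n hn => ?_, ?_⟩
  · simp only [hM i n ((le_max_left _ _).trans hn), hM' i n ((le_max_right _ _).trans hn),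
      Set.univ_inter]
  · ext x
    simp only [Set.mem_inter_iff, Set.mem_ofPred_eq, forall_and]

/-- Together with the π-system property, this reduces equality of laws and vanishing of integrals to
finitely many coordinates. -/
theorem generateFrom_rectangles :
    (inferInstance : MeasurableSpace (∀ i, ℕ → S i))
      = MeasurableSpace.generateFrom (rectangles S) := by
  apply le_antisymm
  · refine iSup_le fun i => ?_
    rw [← measurable_iff_comap_le]
    refine @measurable_pi_lambda _ _ _ (MeasurableSpace.generateFrom (rectangles S)) _ _ fun n => ?_
    intro E hE
    apply MeasurableSpace.measurableSet_generateFrom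
    classical
    refine ⟨fun j m => if h : j = i ∧ m = n then h.1 ▸ E else Set.univ, n + 1, fun j m => ?_,
      fun j m hm => dif_neg (by omega), ?_⟩
    · dsimp only
      split_ifs with h
      · obtain ⟨rfl, rfl⟩ := h; exact hE
      · exact MeasurableSet.univ
    · ext x
      constructor
      · intro hx j m
        dsimp only
        split_ifs with h
        · obtain ⟨rfl, rfl⟩ := h; exact hx
        · trivial
      · intro hx
        have := hx i n
        dsimp only at this
        rwa [dif_pos ⟨rfl, rfl⟩] at this
  · apply MeasurableSpace.generateFrom_le
    rintro _ ⟨D, M, hD, -, rfl⟩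
    simp only [Set.ofPred_forall]
    exact MeasurableSet.iInter fun i => MeasurableSet.iInter fun n =>
      measurable_coordinate i n (hD i n)

theorem measurable_permute (τ : Fin C → Equiv.Perm ℕ) :
    Measurable fun (x : ∀ i, ℕ → S i) i n => x i (τ i n) :=
  measurable_pi_lambda _ fun i => measurable_pi_lambda _ fun n => measurable_coordinate i (τ i n)

/-- A function measurable for the `k`-multi-exchangeable sets is invariant under permutations of the
first `k` coordinates. -/
theorem apply_permute_of_measurable_kMultiExchangeableSets {k : ℕ} {G : (∀ i, ℕ → S i) → ℝ}
    (hG : Measurable[kMultiExchangeableSets S k] G) {τ : Fin C → Equiv.Perm ℕ}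
    (hτ : ∀ i n, k ≤ n → τ i n = n) (x : ∀ i, ℕ → S i) : G (fun i n => x i (τ i n)) = G x :=
  -- The level set of `G` through `x` is a `k`-multi-exchangeable set.
  ((hG (measurableSet_singleton (G x))).2 τ hτ x).1 rfl

end Configurations

/-! ### Invariance of the law and of integrals under finite permutations -/

section Invariance

variable {Ω : Type*} [MeasurableSpace Ω] {P : Measure Ω}
  {C : ℕ} {S : Fin C → Type*} [∀ i, MeasurableSpace (S i)] {X : ∀ i, ℕ → Ω → S i}

theorem measurable_configuration (hXm : ∀ i n, Measurable (X i n)) :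
    Measurable fun ω i n => X i n ω :=
  measurable_pi_lambda _ fun i => measurable_pi_lambda _ fun n => hXm i n

/-- The law of a multi-exchangeable system is invariant under finite permutations. -/
theorem MultiExchangeable.map_permute [IsProbabilityMeasure P] (hX : MultiExchangeable P X)
    (hXm : ∀ i n, Measurable (X i n)) {τ : Fin C → Equiv.Perm ℕ} {k : ℕ}
    (hτ : ∀ i n, k ≤ n → τ i n = n) :
    P.map (fun ω i n => X i (τ i n) ω) = P.map (fun ω i n => X i n ω) := by
  have hm := measurable_configuration hXm
  have hmτ : Measurable fun ω i n => X i (τ i n) ω := (measurable_permute τ).comp hm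
  have := Measure.isProbabilityMeasure_map (μ := P) hmτ.aemeasurable
  refine ext_of_generate_finite _ generateFrom_rectangles isPiSystem_rectangles ?_ ?_
  · rintro _ ⟨D, M, hD, hM, rfl⟩
    let N := max M k
    have hlt : ∀ i n, τ i n < N ↔ n < N := by
      intro i n
      have hfix : ∀ m, N ≤ m → τ i m = m := fun m h => hτ i m ((le_max_right _ _).trans h)
      constructor
      · intro h
        by_contra! h'
        rw [hfix n h'] at h
        omega
      · intro h
        by_contra! h'
        have := (τ i).injective (hfix _ h')
        omega
    -- Beyond `N` every `τ i` is the identity, so it restricts to a permutation of the first `N`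
    -- indices, to which the finite hypothesis applies.
    let σ : ∀ _ : Fin C, Equiv.Perm (Fin N) := fun i =>
      (Fin.equivSubtype.trans ((τ i).subtypePerm (hlt i))).trans Fin.equivSubtype.symm
    have hσ : ∀ i n, ((σ i n : Fin N) : ℕ) = τ i n := fun i n => rfl
    have key := hX (fun _ => N) σ
    let R : Set (∀ _ : Fin C, Fin N → S _) := {y | ∀ i (n : Fin N), y i n ∈ D i n}
    have hR : MeasurableSet R := by
      simp only [R, Set.ofPred_forall]
      exact MeasurableSet.iInter fun i => MeasurableSet.iInter fun n =>
        ((measurable_pi_apply n).comp (measurable_pi_apply i)) (hD i n)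
    have hB : MeasurableSet {x : ∀ i, ℕ → S i | ∀ i n, x i n ∈ D i n} := by
      simp only [Set.ofPred_forall]
      exact MeasurableSet.iInter fun i => MeasurableSet.iInter fun n =>
        measurable_coordinate i n (hD i n)
    have hall : ∀ x : ∀ i, ℕ → S i,
        (∀ i n, x i n ∈ D i n) ↔ ∀ i (n : Fin N), x i n ∈ D i n := by
      refine fun x => ⟨fun h i n => h i n, fun h i n => ?_⟩
      rcases lt_or_ge n N with hn | hn
      · exact h i ⟨n, hn⟩
      · rw [hM i n ((le_max_left _ _).trans hn)]; trivial
    have h1 := congrArg (fun μ => μ R) key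
    simp only at h1
    rw [Measure.map_apply _ hR, Measure.map_apply _ hR] at h1
    · rw [Measure.map_apply hmτ hB, Measure.map_apply hm hB]
      convert h1 using 2
      · ext ω; exact hall _
      · ext ω; exact hall _
    · exact measurable_pi_lambda _ fun i => measurable_pi_lambda _ fun n => hXm i n
    · exact measurable_pi_lambda _ fun i => measurable_pi_lambda _ fun n => hXm i _
  · rw [Measure.map_apply hmτ .univ, Measure.map_apply hm .univ]; rfl

/-- Integrals against functions of a multi-exchangeable σ-algebra are invariant under finite
permutations. -/
theorem MultiExchangeable.integral_mul_permute [IsProbabilityMeasure P] (hX : MultiExchangeable P X)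
    (hXm : ∀ i n, Measurable (X i n)) {τ : Fin C → Equiv.Perm ℕ} {k : ℕ} (hk : 1 ≤ k)
    (hτ : ∀ i n, k ≤ n → τ i n = n) {g : Ω → ℝ} (hg : Measurable[multiExchangeableSigma X] g)
    {H : (∀ i, ℕ → S i) → ℝ} (hH : Measurable H) :
    ∫ ω, g ω * H (fun i n => X i (τ i n) ω) ∂P = ∫ ω, g ω * H (fun i n => X i n ω) ∂P := by
  have hm := measurable_configuration hXm
  have hmτ : Measurable fun ω i n => X i (τ i n) ω := (measurable_permute τ).comp hm
  have hle : multiExchangeableSigma X ≤ kMultiExchangeableSigma X k := iInf₂_le k hk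
  -- `g` is a `k`-symmetric function of the configuration; permuting its argument too costs nothing,
  -- and then only the law of the permuted system matters.
  obtain ⟨G, hG, rfl⟩ := @Measurable.exists_eq_measurable_comp _ _ _ (kMultiExchangeableSets S k)
    _ _ _ _ _ (hg.mono hle le_rfl)
  have hG' : Measurable G := hG.mono (fun _ h => h.1) le_rfl
  have hGH : Measurable fun x => G x * H x := hG'.mul hH
  calc ∫ ω, G (fun i n => X i n ω) * H (fun i n => X i (τ i n) ω) ∂P
      = ∫ ω, G (fun i n => X i (τ i n) ω) * H (fun i n => X i (τ i n) ω) ∂P := by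
        refine integral_congr_ae (ae_of_all _ fun ω => ?_)
        simp only
        rw [← apply_permute_of_measurable_kMultiExchangeableSets hG hτ]
    _ = ∫ x, G x * H x ∂(P.map fun ω i n => X i (τ i n) ω) :=
        (integral_map hmτ.aemeasurable hGH.aestronglyMeasurable).symm
    _ = ∫ x, G x * H x ∂(P.map fun ω i n => X i n ω) := by rw [hX.map_permute hXm hτ]
    _ = ∫ ω, G (fun i n => X i n ω) * H (fun i n => X i n ω) ∂P :=
        integral_map hm.aemeasurable hGH.aestronglyMeasurable

end Invariance

/-! ### Asymptotic frequencies -/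

section Frequency

theorem limsup_le_limsup_of_tendsto_sub {u v : ℕ → ℝ} (hu : ∀ n, 0 ≤ u n) (hv0 : ∀ n, 0 ≤ v n)
    (hv1 : ∀ n, v n ≤ 1) (h : Tendsto (fun n => u n - v n) atTop (𝓝 0)) :
    limsup u atTop ≤ limsup v atTop := by
  have hcu : IsCoboundedUnder (· ≤ ·) atTop u := isCoboundedUnder_le_of_le (x := 0) _ hu
  have hcv : IsCoboundedUnder (· ≤ ·) atTop v := isCoboundedUnder_le_of_le (x := 0) _ hv0
  have hbv : IsBoundedUnder (· ≤ ·) atTop v := isBoundedUnder_of ⟨1, hv1⟩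
  refine le_of_forall_pos_le_add fun ε hε => ?_
  rw [← limsup_add_const _ _ _ hbv hcv]
  refine limsup_le_limsup ?_ hcu
    (isBoundedUnder_of ⟨1 + ε, fun n => by have := hv1 n; linarith⟩)
  filter_upwards [h.eventually_le_const hε] with n hn
  linarith

variable {Ω S : Type*}

/-- The asymptotic frequency of the visits of the sequence `Y` to the set `D`. -/
noncomputable def frequency (Y : ℕ → Ω → S) (D : Set S) (ω : Ω) : ℝ :=
  limsup (fun N : ℕ => (∑ n ∈ Finset.range N, D.indicator (fun _ => (1 : ℝ)) (Y n ω)) / N) atTop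

theorem indicator_one_nonneg (D : Set S) (x : S) : 0 ≤ D.indicator (fun _ => (1 : ℝ)) x :=
  Set.indicator_nonneg (fun _ _ => zero_le_one) x

theorem indicator_one_le_one (D : Set S) (x : S) : D.indicator (fun _ => (1 : ℝ)) x ≤ 1 :=
  Set.indicator_le' (fun _ _ => le_rfl) (fun _ _ => zero_le_one) x

theorem average_mem_Icc {f : ℕ → ℝ} (h0 : ∀ n, 0 ≤ f n) (h1 : ∀ n, f n ≤ 1) (N : ℕ) :
    (∑ n ∈ Finset.range N, f n) / N ∈ Set.Icc (0 : ℝ) 1 := by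
  refine ⟨div_nonneg (Finset.sum_nonneg fun n _ => h0 n) (Nat.cast_nonneg _),
    div_le_one_of_le₀ ?_ (Nat.cast_nonneg _)⟩
  calc ∑ n ∈ Finset.range N, f n ≤ ∑ n ∈ Finset.range N, (1 : ℝ) :=
        Finset.sum_le_sum fun n _ => h1 n
    _ = N := by simp

/-- Finitely many terms do not contribute to an asymptotic frequency. -/
theorem frequency_eq_limsup_tail (Y : ℕ → Ω → S) (D : Set S) (k : ℕ) (ω : Ω) :
    frequency Y D ω = limsup (fun N : ℕ => (∑ n ∈ Finset.range N,
      if k ≤ n then D.indicator (fun _ => (1 : ℝ)) (Y n ω) else 0) / N) atTop := by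
  set f : ℕ → ℝ := fun n => D.indicator (fun _ => (1 : ℝ)) (Y n ω) with hf
  have hf0 : ∀ n, 0 ≤ f n := fun n => indicator_one_nonneg _ _
  have hf1 : ∀ n, f n ≤ 1 := fun n => indicator_one_le_one _ _
  have hg0 : ∀ n, 0 ≤ if k ≤ n then f n else 0 := fun n => by
    split_ifs
    exacts [hf0 n, le_rfl]
  have hg1 : ∀ n, (if k ≤ n then f n else 0) ≤ 1 := fun n => by
    split_ifs
    exacts [hf1 n, zero_le_one]
  have hdiff : Tendsto (fun N : ℕ => (∑ n ∈ Finset.range N, f n) / N -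
      (∑ n ∈ Finset.range N, if k ≤ n then f n else 0) / N) atTop (𝓝 0) := by
    refine squeeze_zero (g := fun N : ℕ => (k : ℝ) / N) (fun N => ?_) (fun N => ?_)
      (tendsto_const_div_atTop_nhds_zero_nat _)
    · rw [← sub_div, ← Finset.sum_sub_distrib]
      refine div_nonneg (Finset.sum_nonneg fun n _ => ?_) (Nat.cast_nonneg _)
      split_ifs
      · simp
      · simpa using hf0 n
    · rw [← sub_div, ← Finset.sum_sub_distrib]
      refine div_le_div_of_nonneg_right ?_ (Nat.cast_nonneg _)
      calc ∑ n ∈ Finset.range N, (f n - if k ≤ n then f n else 0)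
          ≤ ∑ n ∈ Finset.range N, if n < k then (1 : ℝ) else 0 := by
            refine Finset.sum_le_sum fun n _ => ?_
            by_cases h : k ≤ n
            · simp [h, not_lt.2 h]
            · simpa [h, not_le.1 h] using hf1 n
        _ = (((Finset.range N).filter (· < k)).card : ℝ) := by
            rw [Finset.sum_boole]
        _ ≤ k := by
            have : (Finset.range N).filter (· < k) ⊆ Finset.range k := fun n hn => by
              simp only [Finset.mem_filter, Finset.mem_range] at hn ⊢
              exact hn.2
            simpa using Nat.cast_le (α := ℝ).2 (Finset.card_le_card this)
  refine le_antisymm ?_ ?_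
  · exact limsup_le_limsup_of_tendsto_sub (fun N => (average_mem_Icc hf0 hf1 N).1)
      (fun N => (average_mem_Icc hg0 hg1 N).1) (fun N => (average_mem_Icc hg0 hg1 N).2) hdiff
  · refine limsup_le_limsup_of_tendsto_sub (fun N => (average_mem_Icc hg0 hg1 N).1)
      (fun N => (average_mem_Icc hf0 hf1 N).1) (fun N => (average_mem_Icc hf0 hf1 N).2) ?_
    simpa using hdiff.neg

theorem frequency_mem_Icc (Y : ℕ → Ω → S) (D : Set S) (ω : Ω) :
    frequency Y D ω ∈ Set.Icc (0 : ℝ) 1 := by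
  have h := fun N => average_mem_Icc (f := fun n => D.indicator (fun _ => (1 : ℝ)) (Y n ω))
    (fun n => indicator_one_nonneg _ _) (fun n => indicator_one_le_one _ _) N
  constructor
  · exact le_limsup_of_frequently_le (Frequently.of_forall fun N => (h N).1)
      (isBoundedUnder_of ⟨1, fun N => (h N).2⟩)
  · exact limsup_le_of_le (isCoboundedUnder_le_of_le (x := 0) _ fun N => (h N).1)
      (Eventually.of_forall fun N => (h N).2)

end Frequency

/-! ### Tail measurability of frequencies and conditional independence -/

section System

variable {Ω : Type*} {C : ℕ} {S : Fin C → Type*} [∀ i, MeasurableSpace (S i)]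
  {X : ∀ i, ℕ → Ω → S i}

theorem multiTailSigma_le_multiExchangeableSigma :
    multiTailSigma X ≤ multiExchangeableSigma X := by
  refine le_iInf₂ fun k _ => (iInf_le _ k).trans ?_
  refine iSup_le fun i => iSup₂_le fun n hn => ?_
  rintro _ ⟨E, hE, rfl⟩
  refine ⟨{x | x i n ∈ E}, ⟨measurable_coordinate i n hE, fun σ hσ x => ?_⟩, rfl⟩
  simp only [Set.mem_ofPred_eq, hσ i n hn]

theorem multiExchangeableSigma_le_comap :
    multiExchangeableSigma X ≤ MeasurableSpace.comap (fun ω i n => X i n ω) inferInstance := by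
  refine (iInf₂_le 1 le_rfl).trans ?_
  rintro _ ⟨B, hB, rfl⟩
  exact ⟨B, hB.1, rfl⟩

/-- Dropping the first `k` terms does not change the limsup, for any `k`. As the limsup is defined
at every `ω`, measurability is exact and not only up to null sets. -/
theorem measurable_frequency_tail {i : Fin C} {D : Set (S i)} (hD : MeasurableSet D) :
    Measurable[multiTailSigma X] (frequency (X i) D) := by
  intro B hB
  rw [MeasurableSpace.measurableSet_iInf]
  intro k
  revert B
  rw [funext fun ω => frequency_eq_limsup_tail (X i) D k ω]
  set m := ⨆ (i : Fin C) (n : ℕ) (_ : k ≤ n), MeasurableSpace.comap (X i n) inferInstance with hm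
  refine Measurable.limsup fun N => ?_
  refine Measurable.div_const (Finset.measurable_fun_sum _ fun n _ => ?_) _
  split_ifs with h
  · refine (measurable_const.indicator hD).comp ?_
    rw [measurable_iff_comap_le]
    exact le_iSup_of_le i (le_iSup₂_of_le n h le_rfl)
  · exact measurable_const

variable [mΩ : MeasurableSpace Ω] {P : Measure Ω}

theorem multiExchangeableSigma_le (hXm : ∀ i n, Measurable (X i n)) :
    multiExchangeableSigma X ≤ mΩ :=
  multiExchangeableSigma_le_comap.trans (measurable_configuration hXm).comap_le

theorem measurable_indicator_one_comp (hXm : ∀ i n, Measurable (X i n)) {i : Fin C} {D : Set (S i)}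
    (hD : MeasurableSet D) (n : ℕ) :
    Measurable fun ω => D.indicator (fun _ => (1 : ℝ)) (X i n ω) :=
  (measurable_const.indicator hD).comp (hXm i n)

variable [IsProbabilityMeasure P]

theorem MultiExchangeable.ae_tendsto_frequency (hX : MultiExchangeable P X)
    (hXm : ∀ i n, Measurable (X i n)) {i : Fin C} {D : Set (S i)} (hD : MeasurableSet D) :
    ∀ᵐ ω ∂P, Tendsto (fun N : ℕ =>
      (∑ n ∈ Finset.range N, D.indicator (fun _ => (1 : ℝ)) (X i n ω)) / N) atTop
      (𝓝 (frequency (X i) D ω)) := by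
  have hcoord : ∀ n, Measurable fun x : ∀ i, ℕ → S i =>
      D.indicator (fun _ => (1 : ℝ)) (x i n) := fun n =>
    (measurable_const.indicator hD).comp (measurable_coordinate i n)
  have hab : ∀ n m, n ≠ m → ∫ ω, D.indicator (fun _ => (1 : ℝ)) (X i n ω) *
      D.indicator (fun _ => (1 : ℝ)) (X i m ω) ∂P = ∫ ω, D.indicator (fun _ => (1 : ℝ)) (X i 0 ω) *
      D.indicator (fun _ => (1 : ℝ)) (X i 1 ω) ∂P := by
    intro n m hnm
    -- The first swap sends `0` to `n`; the second sends the image of `1` to `m` and does not move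
    -- `n`.
    let τ : Equiv.Perm ℕ := Equiv.swap (Equiv.swap 0 n 1) m * Equiv.swap 0 n
    have h0 : τ 0 = n := by
      simp only [τ, Equiv.Perm.mul_apply, Equiv.swap_apply_left]
      refine Equiv.swap_apply_of_ne_of_ne (fun h => ?_) hnm
      have := (Equiv.swap 0 n).injective (a₁ := 0) (a₂ := 1) (by rw [Equiv.swap_apply_left]; exact h)
      omega
    have h1 : τ 1 = m := by
      simp only [τ, Equiv.Perm.mul_apply, Equiv.swap_apply_left]
    have hfix : ∀ l, n + m + 2 ≤ l → τ l = l := by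
      intro l hl
      simp only [τ, Equiv.Perm.mul_apply, Equiv.swap_apply_def]
      split_ifs <;> omega
    have := hX.integral_mul_permute hXm (τ := fun _ => τ) (k := n + m + 2) (by omega)
      (fun _ l hl => hfix l hl) (g := fun _ => 1) measurable_const ((hcoord 0).mul (hcoord 1))
    simpa [h0, h1] using this
  have haa : ∀ n, ∫ ω, D.indicator (fun _ => (1 : ℝ)) (X i n ω) *
      D.indicator (fun _ => (1 : ℝ)) (X i n ω) ∂P = ∫ ω, D.indicator (fun _ => (1 : ℝ)) (X i 0 ω) *
      D.indicator (fun _ => (1 : ℝ)) (X i 0 ω) ∂P := by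
    intro n
    have := hX.integral_mul_permute hXm (τ := fun _ => Equiv.swap 0 n) (k := n + 1) (by omega)
      (fun _ l hl => Equiv.swap_apply_of_ne_of_ne (by omega) (by omega)) (g := fun _ => 1)
      measurable_const ((hcoord 0).mul (hcoord 0))
    simpa using this
  filter_upwards [ae_exists_tendsto_average (measurable_indicator_one_comp hXm hD)
    (fun n ω => indicator_one_nonneg _ _) (fun n ω => indicator_one_le_one _ _) haa hab]
    with ω ⟨l, hl⟩
  rwa [frequency, hl.limsup_eq]

/-- Given a multi-exchangeable σ-algebra, the particles are conditionally independent, with the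
asymptotic frequencies as conditional laws. -/
theorem MultiExchangeable.integral_mul_prod_indicator (hX : MultiExchangeable P X)
    (hXm : ∀ i n, Measurable (X i n)) {D : ∀ q : Fin C × ℕ, Set (S q.1)}
    (hD : ∀ q, MeasurableSet (D q)) (p : Finset (Fin C × ℕ)) :
    ∀ g : Ω → ℝ, Measurable[multiExchangeableSigma X] g → ∀ K, (∀ ω, |g ω| ≤ K) →
      ∫ ω, g ω * ∏ q ∈ p, (D q).indicator (fun _ => (1 : ℝ)) (X q.1 q.2 ω) ∂P
        = ∫ ω, g ω * ∏ q ∈ p, frequency (X q.1) (D q) ω ∂P := by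
  -- `g` stays universally quantified: the inductive step absorbs the new frequency into it.
  induction p using Finset.induction_on with
  | empty => intro g _ K _; simp
  | insert q₀ p hq₀ ih =>
    intro g hg K hK
    obtain ⟨i, n₀⟩ := q₀
    set f : ℕ → Ω → ℝ := fun n ω => (D (i, n₀)).indicator (fun _ => (1 : ℝ)) (X i n ω) with hf
    set V := frequency (X i) (D (i, n₀)) with hV
    set R : Ω → ℝ := fun ω => ∏ q ∈ p, (D q).indicator (fun _ => (1 : ℝ)) (X q.1 q.2 ω) with hR
    have hgm : Measurable g := hg.mono (multiExchangeableSigma_le hXm) le_rfl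
    have hVm : Measurable[multiExchangeableSigma X] V :=
      (measurable_frequency_tail (hD (i, n₀))).mono multiTailSigma_le_multiExchangeableSigma le_rfl
    have hfm : ∀ n, Measurable (f n) := measurable_indicator_one_comp hXm (hD (i, n₀))
    have hRm : Measurable R := Finset.measurable_fun_prod _ fun q _ =>
      measurable_indicator_one_comp hXm (hD q) q.2
    have hR0 : ∀ ω, 0 ≤ R ω := fun ω => Finset.prod_nonneg fun q _ => indicator_one_nonneg _ _
    have hR1 : ∀ ω, R ω ≤ 1 := fun ω => Finset.prod_le_one (fun q _ => indicator_one_nonneg _ _)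
      fun q _ => indicator_one_le_one _ _
    have hf0 : ∀ n ω, 0 ≤ f n ω := fun n ω => indicator_one_nonneg _ _
    have hf1 : ∀ n ω, f n ω ≤ 1 := fun n ω => indicator_one_le_one _ _
    have hbound : ∀ ω, ∀ t ∈ Set.Icc (0 : ℝ) 1, ‖g ω * (t * R ω)‖ ≤ K := by
      intro ω t ht
      rw [Real.norm_eq_abs, abs_mul, abs_of_nonneg (mul_nonneg ht.1 (hR0 ω))]
      exact mul_le_of_le_one_right (abs_nonneg _) (mul_le_one₀ ht.2 (hR0 ω) (hR1 ω)) |>.trans (hK ω)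
    obtain ⟨m₀, hm₀⟩ : ∃ m₀, ∀ q ∈ insert (i, n₀) p, q.2 < m₀ :=
      ⟨(insert (i, n₀) p).sup Prod.snd + 1, fun q hq =>
        Nat.lt_succ_of_le (Finset.le_sup (f := Prod.snd) hq)⟩
    have hn₀ : n₀ < m₀ := hm₀ _ (Finset.mem_insert_self _ _)
    -- Swapping `n₀` and `m` in class `i` alone leaves the other factors untouched, as `m` lies
    -- beyond all the indices in use.
    have hswap : ∀ m, m₀ ≤ m → ∫ ω, g ω * (f m ω * R ω) ∂P = ∫ ω, g ω * (f n₀ ω * R ω) ∂P := by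
      intro m hm
      let τ : Fin C → Equiv.Perm ℕ := Function.update 1 i (Equiv.swap n₀ m)
      have hτi : τ i = Equiv.swap n₀ m := Function.update_self _ _ _
      have hτ : ∀ j n, m + 1 ≤ n → τ j n = n := by
        intro j n hn
        rcases eq_or_ne j i with rfl | hj
        · rw [hτi]; exact Equiv.swap_apply_of_ne_of_ne (by omega) (by omega)
        · simp [τ, Function.update_of_ne hj]
      have hτp : ∀ q ∈ p, τ q.1 q.2 = q.2 := by
        rintro ⟨j, n⟩ hq
        rcases eq_or_ne j i with rfl | hj
        · have h1 : n < m₀ := hm₀ _ (Finset.mem_insert_of_mem hq)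
          have h2 : n ≠ n₀ := by rintro rfl; exact hq₀ hq
          change τ j n = n
          rw [hτi]; exact Equiv.swap_apply_of_ne_of_ne h2 (by omega)
        · simp [τ, Function.update_of_ne hj]
      have key := hX.integral_mul_permute hXm (by omega) hτ hg
        (H := fun x => (D (i, n₀)).indicator (fun _ => (1 : ℝ)) (x i n₀) *
          ∏ q ∈ p, (D q).indicator (fun _ => (1 : ℝ)) (x q.1 q.2))
        (((measurable_const.indicator (hD (i, n₀))).comp (measurable_coordinate i n₀)).mul
          (Finset.measurable_fun_prod _ fun q _ =>
            (measurable_const.indicator (hD q)).comp (measurable_coordinate q.1 q.2)))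
      rw [← key]
      refine integral_congr_ae (ae_of_all _ fun ω => ?_)
      simp only [hf, hR, hτi, Equiv.swap_apply_left]
      congr 2
      exact Finset.prod_congr rfl fun q hq => by rw [hτp q hq]
    have hint : ∀ n, Integrable (fun ω => g ω * (f n ω * R ω)) P := fun n =>
      Integrable.of_bound (hgm.mul ((hfm n).mul hRm)).aestronglyMeasurable K
        (ae_of_all _ fun ω => hbound ω _ ⟨hf0 n ω, hf1 n ω⟩)
    -- The integrals are constant from `m₀` on, so their Cesàro means have the same limit. Dominated
    -- convergence gives the other value of this limit.
    have hlim1 : Tendsto (fun N : ℕ => ∫ ω, g ω * ((∑ n ∈ Finset.range N, f n ω) / N * R ω) ∂P)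
        atTop (𝓝 (∫ ω, g ω * (f n₀ ω * R ω) ∂P)) := by
      have hconst : Tendsto (fun n => ∫ ω, g ω * (f n ω * R ω) ∂P) atTop
          (𝓝 (∫ ω, g ω * (f n₀ ω * R ω) ∂P)) :=
        tendsto_const_nhds.congr' (by
          filter_upwards [eventually_ge_atTop m₀] with m hm using (hswap m hm).symm)
      refine hconst.cesaro.congr fun N => ?_
      rw [← integral_finsetSum _ fun n _ => hint n, ← integral_const_mul]
      refine integral_congr_ae (ae_of_all _ fun ω => ?_)
      simp only
      rw [← Finset.mul_sum, ← Finset.sum_mul]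
      ring
    have hlim2 : Tendsto (fun N : ℕ => ∫ ω, g ω * ((∑ n ∈ Finset.range N, f n ω) / N * R ω) ∂P)
        atTop (𝓝 (∫ ω, g ω * (V ω * R ω) ∂P)) := by
      refine tendsto_integral_of_dominated_convergence (fun _ => K) (fun N => ?_)
        (integrable_const K) (fun N => ae_of_all _ fun ω => ?_) ?_
      · exact (hgm.mul (((Finset.measurable_fun_sum _ fun n _ => hfm n).div_const _).mul
          hRm)).aestronglyMeasurable
      · exact hbound ω _ (average_mem_Icc (fun n => hf0 n ω) (fun n => hf1 n ω) N)
      · filter_upwards [hX.ae_tendsto_frequency hXm (hD (i, n₀))] with ω hω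
        exact (hω.mul_const _).const_mul _
    simp_rw [Finset.prod_insert hq₀]
    have hgV : ∀ ω, |g ω * V ω| ≤ K := fun ω => by
      have := frequency_mem_Icc (X i) (D (i, n₀)) ω
      rw [abs_mul, abs_of_nonneg this.1]
      exact (mul_le_of_le_one_right (abs_nonneg _) this.2).trans (hK ω)
    calc ∫ ω, g ω * (f n₀ ω * R ω) ∂P = ∫ ω, g ω * (V ω * R ω) ∂P :=
          tendsto_nhds_unique hlim1 hlim2
      _ = ∫ ω, g ω * V ω * R ω ∂P := by simp_rw [mul_assoc]
      _ = ∫ ω, g ω * V ω * ∏ q ∈ p, frequency (X q.1) (D q) ω ∂P :=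
          ih (fun ω => g ω * V ω) (hg.mul hVm) K hgV
      _ = _ := by simp_rw [mul_assoc]; rfl

end System

/-! ### Construction of a directing measure vector -/

section DirectingMeasure

/-- Regular conditional laws, as random probability measures. -/
theorem exists_conditionalLaw {Ω S : Type*} {m mΩ : MeasurableSpace Ω} {P : Measure Ω}
    [IsFiniteMeasure P] [MeasurableSpace S] [StandardBorelSpace S] [Nonempty S] (hm : m ≤ mΩ)
    {Y : Ω → S} (hY : Measurable Y) :
    ∃ Λ : Ω → ProbabilityMeasure S, Measurable[m] Λ ∧ ∀ D, MeasurableSet D →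
      (fun ω => (Λ ω : Measure S).real D) =ᵐ[P] P⟦Y ⁻¹' D | m⟧ := by
  -- Conditioning on the identity map into `Ω` equipped with `m` is conditioning on `m`, and makes
  -- the kernel `m`-measurable.
  let κ := @condDistrib Ω Ω S _ _ _ mΩ m Y id P _
  refine ⟨fun ω => ⟨κ ω, inferInstance⟩, ?_, fun D hD => ?_⟩
  · exact @Measurable.subtype_mk _ _ m _ (fun μ : Measure S => IsProbabilityMeasure μ) _
      (@Kernel.measurable _ _ m _ κ) _
  · have := @condDistrib_ae_eq_condExp Ω Ω S _ _ _ mΩ P _ id Y m D (measurable_id'' hm) hY hD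
    rwa [MeasurableSpace.comap_id] at this

/-- The empirical measure of a set is the average number of visits to it. -/
theorem coe_empiricalMeasure_apply {S : Type*} [MeasurableSpace S] (x : ℕ → S) (N : ℕ) {D : Set S}
    (hD : MeasurableSet D) : ((empiricalMeasure x N D : NNReal) : ℝ)
      = (∑ n ∈ Finset.range (N + 1), D.indicator (fun _ => (1 : ℝ)) (x n)) / (N + 1 : ℕ) := by
  rw [← ProbabilityMeasure.measureReal_eq_coe_coeFn]
  simp only [empiricalMeasure, ProbabilityMeasure.coe_mk]
  rw [measureReal_ennreal_smul_apply, measureReal_def, Measure.finsetSum_apply,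
    ENNReal.toReal_sum fun n _ => measure_ne_top _ _, ENNReal.toReal_inv, ENNReal.toReal_natCast,
    div_eq_inv_mul]
  congr 1
  refine Finset.sum_congr rfl fun n _ => ?_
  rw [Measure.dirac_apply' _ hD]
  by_cases h : x n ∈ D <;> simp [h]

/-- In a second countable space, weak convergence of probability measures can be tested on
countably many open sets. -/
theorem exists_countable_convergence_determining (S : Type*) [TopologicalSpace S]
    [SecondCountableTopology S] [MeasurableSpace S] [OpensMeasurableSpace S] :
    ∃ 𝒰 : Set (Set S), 𝒰.Countable ∧ (∀ U ∈ 𝒰, MeasurableSet U) ∧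
      ∀ (μ : ℕ → ProbabilityMeasure S) (ν : ProbabilityMeasure S),
        (∀ U ∈ 𝒰, Tendsto (fun N => μ N U) atTop (𝓝 (ν U))) → Tendsto μ atTop (𝓝 ν) := by
  let b := TopologicalSpace.countableBasis S
  -- Finite intersections turn the basis into a π-system while preserving countability.
  let 𝒰 : Set (Set S) := Set.sInter '' {t : Set (Set S) | t.Finite ∧ t ⊆ b}
  have hmeas : ∀ U ∈ 𝒰, MeasurableSet U := by
    rintro _ ⟨t, ⟨htf, htb⟩, rfl⟩
    exact (htf.isOpen_sInter fun u hu =>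
      TopologicalSpace.isOpen_of_mem_countableBasis (htb hu)).measurableSet
  refine ⟨𝒰, (Set.countable_ofPred_finite_subset
    (TopologicalSpace.countable_countableBasis S)).image _, hmeas, fun μ ν h => ?_⟩
  refine IsPiSystem.tendsto_probabilityMeasure_of_tendsto_of_mem (S := 𝒰) ?_ hmeas ?_ h
  · rintro _ ⟨t, ⟨htf, htb⟩, rfl⟩ _ ⟨t', ⟨htf', htb'⟩, rfl⟩ -
    exact ⟨t ∪ t', ⟨htf.union htf', Set.union_subset htb htb'⟩, Set.sInter_union _ _⟩
  · intro u hu x hx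
    obtain ⟨v, hv, hxv, hvu⟩ :=
      (TopologicalSpace.isBasis_countableBasis S).exists_subset_of_mem_open hx hu
    refine ⟨v, ⟨{v}, ⟨Set.finite_singleton v, Set.singleton_subset_iff.2 hv⟩,
      Set.sInter_singleton v⟩, ?_, hvu⟩
    exact (TopologicalSpace.isOpen_of_mem_countableBasis hv).mem_nhds hxv

variable {Ω : Type*} [mΩ : MeasurableSpace Ω] {P : Measure Ω} [IsProbabilityMeasure P]
  {C : ℕ} {S : Fin C → Type*} [∀ i, MeasurableSpace (S i)] {X : ∀ i, ℕ → Ω → S i}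

/-- The asymptotic frequencies are the conditional probabilities given the tail. -/
theorem MultiExchangeable.frequency_ae_eq_condExp (hX : MultiExchangeable P X)
    (hXm : ∀ i n, Measurable (X i n)) {i : Fin C} {D : Set (S i)} (hD : MeasurableSet D) :
    frequency (X i) D =ᵐ[P] P⟦X i 0 ⁻¹' D | multiTailSigma X⟧ := by
  have hle : multiTailSigma X ≤ mΩ :=
    multiTailSigma_le_multiExchangeableSigma.trans (multiExchangeableSigma_le hXm)
  have hVm := measurable_frequency_tail (X := X) hD
  have hVint : Integrable (frequency (X i) D) P :=
    Integrable.of_bound (hVm.mono hle le_rfl).aestronglyMeasurable 1 (ae_of_all _ fun ω => by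
      rw [Real.norm_eq_abs, abs_of_nonneg (frequency_mem_Icc _ _ _).1]
      exact (frequency_mem_Icc _ _ _).2)
  refine ae_eq_condExp_of_forall_setIntegral_eq hle
    ((integrable_const _).indicator (hXm i 0 hD)) (fun _ _ _ => hVint.integrableOn)
    (fun A hA _ => ?_) hVm.stronglyMeasurable.aestronglyMeasurable
  have hgm : Measurable[multiExchangeableSigma X] (A.indicator fun _ => (1 : ℝ)) :=
    Measurable.indicator measurable_const (multiTailSigma_le_multiExchangeableSigma A hA)
  -- Only the site `(i, 0)` enters the product; `Set.univ` fills the other sites of the dependent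
  -- family.
  have key := hX.integral_mul_prod_indicator hXm
    (D := Function.update (fun q : Fin C × ℕ => (Set.univ : Set (S q.1))) (i, 0) D) (fun q => by
      rcases eq_or_ne q (i, 0) with rfl | hq
      · rw [Function.update_self]; exact hD
      · rw [Function.update_of_ne hq]; exact MeasurableSet.univ) {(i, 0)}
    _ hgm 1 (fun ω => by
      rw [abs_of_nonneg (indicator_one_nonneg _ _)]; exact indicator_one_le_one _ _)
  simp only [Finset.prod_singleton, Function.update_self] at key
  rw [← integral_indicator (hle A hA), ← integral_indicator (hle A hA)]
  convert key.symm using 2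
  · ext ω; by_cases h : ω ∈ A <;> simp [h]
  · ext ω; by_cases h : ω ∈ A <;> by_cases h' : X i 0 ω ∈ D <;> simp [h, h']

/-- There are tail measurable random probability measures which give the asymptotic frequencies. -/
theorem MultiExchangeable.exists_frequency_measure [∀ i, StandardBorelSpace (S i)]
    (hX : MultiExchangeable P X) (hXm : ∀ i n, Measurable (X i n)) :
    ∃ Λ : ∀ i, Ω → ProbabilityMeasure (S i), (∀ i, Measurable[multiTailSigma X] (Λ i)) ∧
      ∀ i D, MeasurableSet D →
        (fun ω => (Λ i ω : Measure (S i)).real D) =ᵐ[P] frequency (X i) D := by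
  have hle : multiTailSigma X ≤ mΩ :=
    multiTailSigma_le_multiExchangeableSigma.trans (multiExchangeableSigma_le hXm)
  have : ∀ i, Nonempty (S i) := fun i => P.nonempty_of_neZero.map (X i 0)
  choose Λ hΛm hΛ using fun i => exists_conditionalLaw (P := P) hle (hXm i 0)
  exact ⟨Λ, hΛm, fun i D hD => (hΛ i D hD).trans (hX.frequency_ae_eq_condExp hXm hD).symm⟩

/-- Random probability measures which give the asymptotic frequencies are directing measures. -/
theorem MultiExchangeable.isDirectingMeasureVector [∀ i, TopologicalSpace (S i)]
    [∀ i, SecondCountableTopology (S i)] [∀ i, OpensMeasurableSpace (S i)]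
    (hX : MultiExchangeable P X) (hXm : ∀ i n, Measurable (X i n))
    {Λ : ∀ i, Ω → ProbabilityMeasure (S i)} (hΛm : ∀ i, Measurable (Λ i))
    (hΛ : ∀ i D, MeasurableSet D →
      (fun ω => (Λ i ω : Measure (S i)).real D) =ᵐ[P] frequency (X i) D) :
    IsDirectingMeasureVector P X Λ := by
  refine fun i => ⟨hΛm i, ?_⟩
  obtain ⟨𝒰, h𝒰c, h𝒰m, h𝒰⟩ := exists_countable_convergence_determining (S i)
  have hae : ∀ᵐ ω ∂P, ∀ U ∈ 𝒰, (Λ i ω : Measure (S i)).real U = frequency (X i) U ω ∧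
      Tendsto (fun N : ℕ => (∑ n ∈ Finset.range N, U.indicator (fun _ => (1 : ℝ)) (X i n ω)) / N)
        atTop (𝓝 (frequency (X i) U ω)) :=
    (ae_ball_iff h𝒰c).2 fun U hU => (hΛ i U (h𝒰m U hU)).and (hX.ae_tendsto_frequency hXm (h𝒰m U hU))
  filter_upwards [hae] with ω hω
  refine h𝒰 _ _ fun U hU => ?_
  rw [← NNReal.tendsto_coe, ← ProbabilityMeasure.measureReal_eq_coe_coeFn, (hω U hU).1]
  simp_rw [coe_empiricalMeasure_apply _ _ (h𝒰m U hU)]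
  -- `empiricalMeasure` averages `N + 1` points, hence the shift.
  exact (tendsto_add_atTop_iff_nat 1).2 (hω U hU).2

end DirectingMeasure

/-! ### Almost sure comparison of the σ-algebras -/

section SigmaAlgebras

theorem measurable_real_directingSigma {Ω : Type*} {C : ℕ} {S : Fin C → Type*}
    [∀ i, MeasurableSpace (S i)] {Λ : ∀ i, Ω → ProbabilityMeasure (S i)} (i : Fin C)
    {D : Set (S i)} (hD : MeasurableSet D) :
    Measurable[directingSigma Λ] fun ω => (Λ i ω : Measure (S i)).real D :=
  have h : Measurable fun μ : ProbabilityMeasure (S i) => (μ : Measure (S i)).real D :=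
    ((Measure.measurable_coe hD).comp measurable_subtype_coe).ennreal_toReal
  have h' : Measurable fun μ : ∀ i, ProbabilityMeasure (S i) => (μ i : Measure (S i)).real D :=
    h.comp (measurable_pi_apply i)
  h'.comp (comap_measurable fun ω i => Λ i ω)

theorem SigmaAELE.of_le {Ω : Type*} {m₁ m₂ mΩ : MeasurableSpace Ω} {P : Measure Ω} (h : m₁ ≤ m₂) :
    SigmaAELE m₁ m₂ P :=
  fun A hA => ⟨A, h A hA, EventuallyEq.rfl⟩

theorem SigmaAELE.trans {Ω : Type*} {m₁ m₂ m₃ mΩ : MeasurableSpace Ω} {P : Measure Ω}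
    (h : SigmaAELE m₁ m₂ P) (h' : SigmaAELE m₂ m₃ P) : SigmaAELE m₁ m₃ P := fun A hA => by
  obtain ⟨B, hB, hAB⟩ := h A hA
  obtain ⟨D, hD, hBD⟩ := h' B hB
  exact ⟨D, hD, hAB.trans hBD⟩

variable {Ω : Type*} [mΩ : MeasurableSpace Ω] {P : Measure Ω}
  {C : ℕ} {S : Fin C → Type*} [∀ i, MeasurableSpace (S i)] {X : ∀ i, ℕ → Ω → S i}

theorem sigmaAELE_directingSigma_of_ae_eq {Λ Λ' : ∀ i, Ω → ProbabilityMeasure (S i)}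
    (h : ∀ i, Λ i =ᵐ[P] Λ' i) : SigmaAELE (directingSigma Λ) (directingSigma Λ') P := by
  rintro _ ⟨B, hB, rfl⟩
  refine ⟨_, ⟨B, hB, rfl⟩, ?_⟩
  filter_upwards [ae_all_iff.2 h] with ω hω
  apply propext
  change (fun i => Λ i ω) ∈ B ↔ (fun i => Λ' i ω) ∈ B
  simp_rw [hω]

/-- A function whose integrals over the events that the configuration is in a rectangle vanish has
vanishing integrals over all events which depend on the configuration. -/
theorem setIntegral_eq_zero_of_rectangles [IsProbabilityMeasure P]
    (hXm : ∀ i n, Measurable (X i n)) {Z : Ω → ℝ} (hZ : Integrable Z P)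
    (h : ∀ R ∈ rectangles S, ∫ ω in (fun ω i n => X i n ω) ⁻¹' R, Z ω ∂P = 0)
    {B : Set (∀ i, ℕ → S i)} (hB : MeasurableSet B) :
    ∫ ω in (fun ω i n => X i n ω) ⁻¹' B, Z ω ∂P = 0 := by
  have hm := measurable_configuration hXm
  have huniv : ∫ ω, Z ω ∂P = 0 := by
    have := h Set.univ ⟨fun _ _ => Set.univ, 0, fun _ _ => .univ, fun _ _ _ => rfl, by simp⟩
    simpa using this
  induction B, hB using MeasurableSpace.induction_on_inter generateFrom_rectangles
    isPiSystem_rectangles with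
  | empty => simp
  | basic R hR => exact h R hR
  | compl B hB ih =>
    rw [Set.preimage_compl, setIntegral_compl (hm hB) hZ, huniv, ih, sub_zero]
  | iUnion f hd hf ih =>
    rw [Set.preimage_iUnion, integral_iUnion (fun j => hm (hf j))
      (fun j k hjk => (hd hjk).preimage _) hZ.integrableOn]
    simp [ih]

/-- A σ-algebra of multi-exchangeable events for which the asymptotic frequencies are measurable
contains almost surely all multi-exchangeable events. -/
theorem MultiExchangeable.sigmaAELE_of_measurable_frequency {Ω : Type*} {m mΩ : MeasurableSpace Ω}
    {P : Measure Ω} [IsProbabilityMeasure P] {X : ∀ i, ℕ → Ω → S i}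
    (hX : MultiExchangeable P X) (hXm : ∀ i n, Measurable (X i n))
    (hmE : m ≤ multiExchangeableSigma X)
    (hm : ∀ i D, MeasurableSet D → ∃ f, Measurable[m] f ∧ f =ᵐ[P] frequency (X i) D) :
    SigmaAELE (multiExchangeableSigma X) m P := by
  intro A hA
  have hle := multiExchangeableSigma_le hXm
  have hmΩ : m ≤ mΩ := hmE.trans hle
  set a : Ω → ℝ := A.indicator fun _ => (1 : ℝ) with ha
  have ham : Measurable[multiExchangeableSigma X] a := measurable_const.indicator hA
  have haint : Integrable a P := (integrable_const _).indicator (hle A hA)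
  have ha0 : ∀ ω, 0 ≤ a ω := fun ω => indicator_one_nonneg _ _
  have ha1 : ∀ ω, a ω ≤ 1 := fun ω => indicator_one_le_one _ _
  -- Truncation gives a version of the conditional expectation bounded at every `ω`, as the
  -- conditional independence identity requires.
  set g : Ω → ℝ := fun ω => max 0 (min (P[a | m] ω) 1) with hg
  have hgm : Measurable[m] g :=
    measurable_const.max (stronglyMeasurable_condExp.measurable.min measurable_const)
  have hg0 : ∀ ω, 0 ≤ g ω := fun ω => le_max_left _ _
  have hg1 : ∀ ω, g ω ≤ 1 := fun ω => max_le zero_le_one (min_le_right _ _)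
  have hgint : Integrable g P :=
    Integrable.of_bound (hgm.mono hmΩ le_rfl).aestronglyMeasurable 1 (ae_of_all _ fun ω => by
      rw [Real.norm_eq_abs, abs_of_nonneg (hg0 ω)]; exact hg1 ω)
  have hgae : g =ᵐ[P] P[a | m] := by
    have h1 : P[a | m] ≤ᵐ[P] P[fun _ => (1 : ℝ) | m] :=
      condExp_mono haint (integrable_const _) (ae_of_all _ ha1)
    rw [condExp_const hmΩ] at h1
    filter_upwards [condExp_nonneg (m := m) (ae_of_all P ha0), h1] with ω h2 h3
    simp only [hg]
    rw [min_eq_left h3]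
    exact max_eq_right h2
  have hrect : ∀ R ∈ rectangles S, ∫ ω in (fun ω i n => X i n ω) ⁻¹' R, a ω - g ω ∂P = 0 := by
    rintro _ ⟨D, M, hD, hM, rfl⟩
    let p : Finset (Fin C × ℕ) := Finset.univ ×ˢ Finset.range M
    choose f hfm hf using hm
    let ψ : Ω → ℝ := fun ω => ∏ q ∈ p, f q.1 (D q.1 q.2) (hD q.1 q.2) ω
    have hψm : Measurable[m] ψ := Finset.measurable_fun_prod _ fun q _ => hfm _ _ _
    have hψ : (fun ω => ∏ q ∈ p, frequency (X q.1) (D q.1 q.2) ω) =ᵐ[P] ψ := by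
      filter_upwards [ae_all_iff.2 fun q : Fin C × ℕ => hf q.1 (D q.1 q.2) (hD q.1 q.2)] with ω hω
      exact Finset.prod_congr rfl fun q _ => (hω q).symm
    have hψ1 : ∀ᵐ ω ∂P, ‖ψ ω‖ ≤ 1 := by
      filter_upwards [hψ] with ω hω
      rw [← hω, Real.norm_eq_abs,
        abs_of_nonneg (Finset.prod_nonneg fun q _ => (frequency_mem_Icc _ _ _).1)]
      exact Finset.prod_le_one (fun q _ => (frequency_mem_Icc _ _ _).1)
        fun q _ => (frequency_mem_Icc _ _ _).2
    have hψs : AEStronglyMeasurable ψ P := (hψm.mono hmΩ le_rfl).aestronglyMeasurable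
    have haψ : Integrable (fun ω => a ω * ψ ω) P := haint.mul_bdd hψs hψ1
    have hgψ : Integrable (fun ω => g ω * ψ ω) P := hgint.mul_bdd hψs hψ1
    -- `ψ` is an `m`-measurable version of the product of frequencies, so it can be pulled out of
    -- the conditional expectation.
    have hpull : ∫ ω, a ω * ψ ω ∂P = ∫ ω, g ω * ψ ω ∂P := by
      rw [← integral_condExp hmΩ]
      refine integral_congr_ae ?_
      filter_upwards [condExp_mul_of_stronglyMeasurable_right hψm.stronglyMeasurable haψ haint,
        hgae] with ω h1 h2
      rw [h2]
      exact h1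
    have hind : ∀ ω, ((fun ω i n => X i n ω) ⁻¹' {x : ∀ i, ℕ → S i | ∀ i n, x i n ∈ D i n}).indicator
        (fun ω => a ω - g ω) ω = (a ω - g ω) *
        ∏ q ∈ p, (D q.1 q.2).indicator (fun _ => (1 : ℝ)) (X q.1 q.2 ω) := by
      intro ω
      by_cases h : ∀ i n, X i n ω ∈ D i n
      · rw [Set.indicator_of_mem (by exact h), Finset.prod_eq_one, mul_one]
        exact fun q _ => Set.indicator_of_mem (h q.1 q.2) _
      · rw [Set.indicator_of_notMem (by exact h)]
        push Not at h
        obtain ⟨i, n, hin⟩ := h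
        have hn : n < M := by
          by_contra! hn
          rw [hM i n hn] at hin
          exact hin trivial
        rw [Finset.prod_eq_zero (i := (i, n)) (by simp [p, hn]) (Set.indicator_of_notMem hin _),
          mul_zero]
    have hRm : MeasurableSet {x : ∀ i, ℕ → S i | ∀ i n, x i n ∈ D i n} := by
      simp only [Set.ofPred_forall]
      exact MeasurableSet.iInter fun i => MeasurableSet.iInter fun n =>
        measurable_coordinate i n (hD i n)
    rw [← integral_indicator (measurable_configuration hXm hRm)]
    simp_rw [hind]
    calc ∫ ω, (a ω - g ω) * ∏ q ∈ p, (D q.1 q.2).indicator (fun _ => (1 : ℝ)) (X q.1 q.2 ω) ∂P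
        = ∫ ω, (a ω - g ω) * ∏ q ∈ p, frequency (X q.1) (D q.1 q.2) ω ∂P :=
          hX.integral_mul_prod_indicator hXm (D := fun q => D q.1 q.2) (fun q => hD q.1 q.2) p
            (fun ω => a ω - g ω) (ham.sub (hgm.mono hmE le_rfl)) 1 fun ω => by
              rw [abs_le]; constructor <;> linarith [ha0 ω, ha1 ω, hg0 ω, hg1 ω]
      _ = ∫ ω, (a ω * ψ ω - g ω * ψ ω) ∂P := by
          refine integral_congr_ae ?_
          filter_upwards [hψ] with ω hω
          rw [hω, sub_mul]
      _ = 0 := by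
          rw [integral_sub haψ hgψ, hpull, sub_self]
  -- Both functions depend on the configuration only, so testing on events of the configuration
  -- suffices.
  have hZ : a =ᵐ[P] g := by
    have hEX := multiExchangeableSigma_le_comap (X := X)
    have hXΩ := (measurable_configuration hXm).comap_le
    refine ae_eq_of_forall_setIntegral_eq_of_sigmaFinite' hXΩ (fun _ _ _ => haint.integrableOn)
      (fun _ _ _ => hgint.integrableOn) ?_
      (ham.mono hEX le_rfl).stronglyMeasurable.aestronglyMeasurable
      (hgm.mono (hmE.trans hEX) le_rfl).stronglyMeasurable.aestronglyMeasurable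
    rintro _ ⟨B, hB, rfl⟩ -
    have := setIntegral_eq_zero_of_rectangles hXm (haint.sub hgint) hrect hB
    simp only [Pi.sub_apply] at this
    rw [integral_sub haint.integrableOn hgint.integrableOn] at this
    linarith
  refine ⟨g ⁻¹' {1}, hgm (measurableSet_singleton 1), ?_⟩
  filter_upwards [hZ] with ω hω
  apply propext
  change ω ∈ A ↔ g ω = 1
  rw [← hω, ha]
  by_cases h : ω ∈ A <;> simp [h]

end SigmaAlgebras

/-! ### The zero-one law -/

section ZeroOne

variable {Ω : Type*} [MeasurableSpace Ω] {P : Measure Ω}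
  {C : ℕ} {S : Fin C → Type*} [∀ i, MeasurableSpace (S i)] {X : ∀ i, ℕ → Ω → S i}

/-- The zero-one law for the tail of an independent multi-class system. -/
theorem measure_zero_or_one_of_measurableSet_multiTailSigma (hXm : ∀ i n, Measurable (X i n))
    (hind : iIndepFun (fun (p : Fin C × ℕ) => X p.1 p.2) P) {A : Set Ω}
    (hA : MeasurableSet[multiTailSigma X] A) : P A = 0 ∨ P A = 1 := by
  let s : Fin C × ℕ → MeasurableSpace Ω := fun p => MeasurableSpace.comap (X p.1 p.2) inferInstance
  -- A cofinite set of sites misses only finitely many, so it contains every site of large enough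
  -- index, in all classes at once.
  have hle : multiTailSigma X ≤ limsup s cofinite := by
    rw [limsup_eq_iInf_iSup]
    refine le_iInf₂ fun t ht => ?_
    obtain ⟨k, hk⟩ := ((mem_cofinite.1 ht).image Prod.snd).bddAbove
    refine (iInf_le _ (k + 1)).trans (iSup_le fun i => iSup₂_le fun n hn => ?_)
    refine le_iSup₂_of_le (i, n) ?_ le_rfl
    by_contra h
    have : n ≤ k := hk ⟨(i, n), h, rfl⟩
    omega
  refine measure_zero_or_one_of_measurableSet_limsup (s := s) (f := cofinite) (p := Set.Finite)
    (ns := fun t : Finset (Fin C × ℕ) => (t : Set (Fin C × ℕ)))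
    (fun p => (hXm p.1 p.2).comap_le) hind (fun t ht => ht.compl_mem_cofinite) ?_
    (fun t => t.finite_toSet) (fun p => ⟨{p}, by simp⟩) (hle A hA)
  classical
  exact Monotone.directed_le fun t t' h => Finset.coe_subset.2 h

end ZeroOne

end MultiExch

/-! ### The main theorem -/

theorem mainTheorem4 {Ω : Type*} [MeasurableSpace Ω] (P : Measure Ω) [IsProbabilityMeasure P]
    (C : ℕ) (hC : 1 ≤ C) (S : Fin C → Type*)
    [∀ i, TopologicalSpace (S i)] [∀ i, PolishSpace (S i)]
    [∀ i, MeasurableSpace (S i)] [∀ i, BorelSpace (S i)]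
    (X : ∀ i, ℕ → Ω → S i) (hXmeas : ∀ i n, Measurable (X i n))
    (hX : MultiExch.MultiExchangeable P X) :
    (∃ Λ : ∀ i, Ω → ProbabilityMeasure (S i), MultiExch.IsDirectingMeasureVector P X Λ) ∧
    (∀ Λ : ∀ i, Ω → ProbabilityMeasure (S i), MultiExch.IsDirectingMeasureVector P X Λ →
      MultiExch.SigmaAEEq (MultiExch.directingSigma Λ) (MultiExch.multiTailSigma X) P ∧
      MultiExch.SigmaAEEq (MultiExch.multiTailSigma X) (MultiExch.multiExchangeableSigma X) P) ∧
    (iIndepFun (fun (p : Fin C × ℕ) => X p.1 p.2) P →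
      ∀ A : Set Ω, MeasurableSet[MultiExch.multiExchangeableSigma X] A → P A = 0 ∨ P A = 1) := by
  have hTE := MultiExch.multiTailSigma_le_multiExchangeableSigma (X := X)
  have hTΩ := hTE.trans (MultiExch.multiExchangeableSigma_le hXmeas)
  obtain ⟨Λ₀, hΛ₀m, hΛ₀⟩ := hX.exists_frequency_measure hXmeas
  have hdir : MultiExch.IsDirectingMeasureVector P X Λ₀ :=
    hX.isDirectingMeasureVector hXmeas (fun i => (hΛ₀m i).mono hTΩ le_rfl) hΛ₀
  have hΛ₀T : MultiExch.directingSigma Λ₀ ≤ MultiExch.multiTailSigma X :=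
    (@measurable_pi_lambda _ _ _ (MultiExch.multiTailSigma X) _ _ hΛ₀m).comap_le
  -- This closes the circle: $\sigma(\Lambda_0)\subset\mathcal T\subset\mathcal E$ holds exactly,
  -- and $\mathcal E\subset\sigma(\Lambda_0)$ almost surely.
  have hEΛ₀ : MultiExch.SigmaAELE (MultiExch.multiExchangeableSigma X)
      (MultiExch.directingSigma Λ₀) P :=
    hX.sigmaAELE_of_measurable_frequency hXmeas (hΛ₀T.trans hTE) fun i D hD =>
      ⟨_, MultiExch.measurable_real_directingSigma i hD, hΛ₀ i D hD⟩
  have hET : MultiExch.SigmaAELE (MultiExch.multiExchangeableSigma X)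
      (MultiExch.multiTailSigma X) P := hEΛ₀.trans (.of_le hΛ₀T)
  refine ⟨⟨Λ₀, hdir⟩, fun Λ hΛ => ?_, fun hind A hA => ?_⟩
  -- Weak limits are unique, so any directing vector is a.s. equal to `Λ₀`.
  · have hae : ∀ i, Λ i =ᵐ[P] Λ₀ i := fun i => by
      filter_upwards [(hΛ i).2, (hdir i).2] with ω h h₀ using tendsto_nhds_unique h h₀
    exact ⟨⟨(MultiExch.sigmaAELE_directingSigma_of_ae_eq hae).trans (.of_le hΛ₀T),
      ((MultiExch.SigmaAELE.of_le hTE).trans hEΛ₀).trans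
        (MultiExch.sigmaAELE_directingSigma_of_ae_eq fun i => (hae i).symm)⟩, .of_le hTE, hET⟩
  · obtain ⟨B, hB, hAB⟩ := hET A hA
    rw [measure_congr hAB]
    exact MultiExch.measure_zero_or_one_of_measurableSet_multiTailSigma hXmeas hind hB
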